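/- All rings are commutative with identity. Fix a finite set $\Delta$ of symbols; a differential ring is a ring on which the elements of $\Delta$ act as pairwise commuting derivations, and a differential homomorphism is a ring homomorphism commuting with these derivations. For a differential ring $R$, let $\operatorname{Spec}^\Delta R$ be the set of prime differential ideals of $R$ (prime ideals stable under $\Delta$) with the Zariski topology, i.e. the subspace topology from $\operatorname{Spec} R$. Let $A$ be a Ritt algebra (a differential ring that is a $\mathbb{Q}$-algebra) such that $\operatorname{Spec}^\Delta A$ is a noetherian topological space. Let $B$ be a differential ring and $f\colon A\to B$ a differential homomorphism making $B$ a differentially finitely generated $A$-algebra (that is, $B$ is generated as a differential $A$-algebra by finitely many elements). Let $f^*_\Delta\colon \operatorname{Spec}^\Delta B\to\operatorname{Spec}^\Delta A$ be the contraction map $\mathfrak q\mapsto \mathfrak q^c=f^{-1}(\mathfrak q)$. Then the following conditions are equivalent: 1. $f$ has the going-down property for differential ideals: for all integers $1\le m<n$, every chain $\mathfrak p_1\supseteq\dots\supseteq\mathfrak p_n$ of prime differential ideals of $A$ and every chain $\mathfrak q_1\supseteq\dots\supseteq\mathfrak q_m$ of prime differential ideals of $B$ with $\mathfrak q_i^c=\mathfrak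 p_i$ for $1\le i\le m$, the second chain can be extended to a chain $\mathfrak q_1\supseteq\dots\supseteq\mathfrak q_n$ of prime differential ideals of $B$ with $\mathfrak q_i^c=\mathfrak p_i$ for $1\le i\le n$. 2. $f^*_\Delta$ is an open map. 3. For every $\mathfrak q\in\operatorname{Spec}^\Delta B$, the contraction map $\operatorname{Spec}^\Delta(B_{\mathfrak q})\to\operatorname{Spec}^\Delta(A_{\mathfrak q^c})$ induced by $f$ is surjective, where the local rings carry the unique derivations extending those of $B$ and $A$. -/

import Mathlib

/-- A differential ring whose derivation operators are indexed by `ι`: a commutative ring with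
pairwise commuting derivations `δ i`. -/
class DiffRing (ι : Type*) (R : Type*) [CommRing R] where
  deriv : ι → Derivation ℤ R R
  deriv_comm : ∀ (i j : ι) (x : R), deriv i (deriv j x) = deriv j (deriv i x)

/-- A ring homomorphism is differential if it commutes with all derivation operators. -/
def IsDiffHom (ι : Type*) {R S : Type*} [CommRing R] [CommRing S] [DiffRing ι R] [DiffRing ι S]
    (f : R →+* S) : Prop :=
  ∀ (i : ι) (x : R), f (DiffRing.deriv i x) = DiffRing.deriv i (f x)

/-- A differential algebra: an algebra whose structure homomorphism is differential. -/
class DiffAlgebra (ι : Type*) (A B : Type*) [CommRing A] [CommRing B] [DiffRing ι A]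
    [DiffRing ι B] [Algebra A B] : Prop where
  isDiffHom_algebraMap : IsDiffHom ι (algebraMap A B)

/-- Differential ideals: ideals stable under all derivation operators. -/
def IsDiffIdeal (ι : Type*) {R : Type*} [CommRing R] [DiffRing ι R] (I : Ideal R) : Prop :=
  ∀ (i : ι), ∀ x ∈ I, DiffRing.deriv i x ∈ I

/-- The differential spectrum: prime differential ideals, with the order (inclusion) and the
Zariski topology induced from the prime spectrum. -/
abbrev DiffSpec (ι : Type*) (R : Type*) [CommRing R] [DiffRing ι R] : Type _ :=
  {p : PrimeSpectrum R // IsDiffIdeal ι p.asIdeal}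

/-- Contraction of prime differential ideals along a differential homomorphism. -/
def DiffSpec.comap {ι R S : Type*} [CommRing R] [CommRing S] [DiffRing ι R] [DiffRing ι S]
    (f : R →+* S) (hf : IsDiffHom ι f) (q : DiffSpec ι S) : DiffSpec ι R :=
  ⟨PrimeSpectrum.comap f q.1, fun i x hx => by
    have h := q.2 i (f x) hx
    rw [← hf i x] at h
    exact h⟩

/-- The differential subalgebra generated by a set `s`. -/
def diffAdjoin (ι A : Type*) {B : Type*} [CommRing A] [CommRing B] [DiffRing ι B]
    [Algebra A B] (s : Set B) : Subalgebra A B :=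
  sInf {C : Subalgebra A B | s ⊆ C ∧ ∀ (i : ι), ∀ x ∈ C, DiffRing.deriv i x ∈ C}

/-- `B` is differentially finitely generated over `A`. -/
def DiffFiniteType (ι A B : Type*) [CommRing A] [CommRing B] [DiffRing ι B]
    [Algebra A B] : Prop :=
  ∃ s : Finset B, diffAdjoin ι A (s : Set B) = ⊤

/-- The going-down property for differential ideals: whenever
`p₁ ⊇ ⋯ ⊇ pₙ` is a chain of prime differential ideals of `R` and `q₁ ⊇ ⋯ ⊇ qₘ` (`1 ≤ m < n`) is
a chain of prime differential ideals of `S` with `qᵢ` contracting to `pᵢ` for `i ≤ m`, the second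
chain extends to a chain `q₁ ⊇ ⋯ ⊇ qₙ` with `qᵢ` contracting to `pᵢ` for `i ≤ n`. -/
def HasDiffGoingDown {ι R S : Type*} [CommRing R] [CommRing S] [DiffRing ι R] [DiffRing ι S]
    (f : R →+* S) (hf : IsDiffHom ι f) : Prop :=
  ∀ (m n : ℕ) (_ : 1 ≤ m) (hmn : m < n) (p : Fin n → DiffSpec ι R) (q : Fin m → DiffSpec ι S),
    Antitone p → Antitone q →
    (∀ i : Fin m, DiffSpec.comap f hf (q i) = p (Fin.castLE hmn.le i)) →
    ∃ q' : Fin n → DiffSpec ι S, Antitone q' ∧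
      (∀ i : Fin m, q' (Fin.castLE hmn.le i) = q i) ∧
      ∀ i : Fin n, DiffSpec.comap f hf (q' i) = p i

/-! ### Localization of differential rings -/

/-- The ring homomorphism `x ↦ x + ε D x` into the dual numbers over an `R`-algebra. -/
def Derivation.toDualHom {R : Type*} [CommRing R] (L : Type*) [CommRing L] [Algebra R L]
    (D : Derivation ℤ R R) : R →+* TrivSqZeroExt L L where
  toFun x := TrivSqZeroExt.inl (algebraMap R L x) + TrivSqZeroExt.inr (algebraMap R L (D x))
  map_one' := by ext <;> simp
  map_mul' x y := by
    ext
    · simp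
    · simp
      rw [Algebra.smul_def, Algebra.smul_def]
      ring
  map_zero' := by ext <;> simp
  map_add' x y := by
    ext
    · simp
    · simp [← Algebra.algebraMap_eq_smul_one]

section Localization

variable {R : Type*} [CommRing R] (M : Submonoid R) (L : Type*) [CommRing L] [Algebra R L]
  [IsLocalization M L]

/-- The extension of `x ↦ x + ε D x` to a localization. -/
noncomputable def Derivation.localizationHom (D : Derivation ℤ R R) : L →+* TrivSqZeroExt L L :=
  IsLocalization.lift (M := M) (g := Derivation.toDualHom L D) fun s => by
    rw [TrivSqZeroExt.isUnit_iff_isUnit_fst]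
    simpa [Derivation.toDualHom] using IsLocalization.map_units L s

theorem Derivation.localizationHom_algebraMap (D : Derivation ℤ R R) (x : R) :
    Derivation.localizationHom M L D (algebraMap R L x) = Derivation.toDualHom L D x :=
  IsLocalization.lift_eq _ x

theorem Derivation.fst_localizationHom (D : Derivation ℤ R R) (x : L) :
    (Derivation.localizationHom M L D x).fst = x := by
  have h : ((TrivSqZeroExt.fstHom L L L).toRingHom.comp (Derivation.localizationHom M L D)) =
      RingHom.id L := by
    apply IsLocalization.ringHom_ext M
    ext x
    simp [Derivation.localizationHom_algebraMap, Derivation.toDualHom]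
  exact congrArg (fun g : L →+* L => g x) h

/-- The extension of a derivation of `R` to a localization `L` of `R`. -/
noncomputable def Derivation.localization (D : Derivation ℤ R R) : Derivation ℤ L L :=
  Derivation.mk'
    (AddMonoidHom.toIntLinearMap
      { toFun := fun x => (Derivation.localizationHom M L D x).snd
        map_zero' := by simp
        map_add' := fun x y => by simp })
    fun x y => by
      simp [TrivSqZeroExt.snd_mul, Derivation.fst_localizationHom, mul_comm]

@[simp]
theorem Derivation.localization_algebraMap (D : Derivation ℤ R R) (x : R) :
    Derivation.localization M L D (algebraMap R L x) = algebraMap R L (D x) := by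
  change (Derivation.localizationHom M L D (algebraMap R L x)).snd = _
  simp [Derivation.localizationHom_algebraMap, Derivation.toDualHom,
    ← Algebra.algebraMap_eq_smul_one]

end Localization

/-- Derivations of a localization are determined by their values on the base ring. -/
theorem Derivation.localization_ext {R : Type*} [CommRing R] (M : Submonoid R) {L : Type*}
    [CommRing L] [Algebra R L] [IsLocalization M L] {D E : Derivation ℤ L L}
    (h : ∀ x : R, D (algebraMap R L x) = E (algebraMap R L x)) : D = E := by
  ext z
  obtain ⟨a, s, hz⟩ := IsLocalization.exists_mk'_eq M z
  have hs : z * algebraMap R L s = algebraMap R L a := by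
    rw [← hz]; exact IsLocalization.mk'_spec L a s
  have h1 := congrArg D hs
  have h2 := congrArg E hs
  rw [Derivation.leibniz] at h1 h2
  rw [h, h] at h1
  simp only [smul_eq_mul] at h1 h2
  have hu := IsLocalization.map_units L s
  apply hu.mul_left_cancel
  linear_combination h1 - h2

theorem Derivation.localization_comm {R : Type*} [CommRing R] (M : Submonoid R) (L : Type*)
    [CommRing L] [Algebra R L] [IsLocalization M L] {D E : Derivation ℤ R R}
    (h : ∀ x, D (E x) = E (D x)) (x : L) :
    Derivation.localization M L D (Derivation.localization M L E x) =
      Derivation.localization M L E (Derivation.localization M L D x) := by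
  have h0 : ⁅Derivation.localization M L D, Derivation.localization M L E⁆ = 0 := by
    apply Derivation.localization_ext M
    intro x
    rw [Derivation.commutator_apply]
    simp [h x]
  have h' := congrArg (fun D : Derivation ℤ L L => D x) h0
  simp only [Derivation.commutator_apply] at h'
  exact sub_eq_zero.mp h'

/-- A localization of a differential ring is a differential ring, with the unique derivations
extending those of the base (that is, given by the quotient rule). -/
noncomputable instance Localization.instDiffRing {ι R : Type*} [CommRing R] [DiffRing ι R]
    (M : Submonoid R) : DiffRing ι (Localization M) where
  deriv i := Derivation.localization M (Localization M) (DiffRing.deriv i)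
  deriv_comm i j x :=
    Derivation.localization_comm M (Localization M) (DiffRing.deriv_comm i j) x

theorem Localization.deriv_algebraMap {ι R : Type*} [CommRing R] [DiffRing ι R]
    (M : Submonoid R) (i : ι) (x : R) :
    DiffRing.deriv i (algebraMap R (Localization M) x) =
      algebraMap R (Localization M) (DiffRing.deriv i x) :=
  Derivation.localization_algebraMap M _ _ x

/-- The homomorphism induced by a differential homomorphism on localizations at primes is
differential. -/
theorem isDiffHom_localRingHom {ι R S : Type*} [CommRing R] [CommRing S] [DiffRing ι R]
    [DiffRing ι S] (f : R →+* S) (hf : IsDiffHom ι f) (I : Ideal R) [I.IsPrime]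
    (J : Ideal S) [J.IsPrime] (hIJ : I = J.comap f) :
    IsDiffHom ι (Localization.localRingHom I J f hIJ) := by
  intro i z
  obtain ⟨a, s, hz⟩ := IsLocalization.exists_mk'_eq I.primeCompl z
  have hs : z * algebraMap R (Localization.AtPrime I) s =
      algebraMap R (Localization.AtPrime I) a := by
    rw [← hz]; exact IsLocalization.mk'_spec _ a s
  have h1 := congrArg (Localization.localRingHom I J f hIJ) (congrArg (DiffRing.deriv i) hs)
  have h2 := congrArg (DiffRing.deriv i) (congrArg (Localization.localRingHom I J f hIJ) hs)
  simp only [Derivation.leibniz, smul_eq_mul, map_add, map_mul, Localization.deriv_algebraMap,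
    Localization.localRingHom_to_map, hf i] at h1 h2
  have hu : IsUnit (algebraMap S (Localization.AtPrime J) (f s)) := by
    have hsJ : f s ∈ J.primeCompl := by
      have := s.2
      subst hIJ
      exact this
    exact IsLocalization.map_units (Localization.AtPrime J) (⟨f s, hsJ⟩ : J.primeCompl)
  apply hu.mul_left_cancel
  linear_combination h1 - h2

/-- For a differential homomorphism `f : R → S` and a prime differential ideal `q` of `S`, the map
`Spec^Δ S_q → Spec^Δ R_{q^c}` of differential spectra of the local rings. -/
noncomputable def DiffSpec.localComap {ι R S : Type*} [CommRing R] [CommRing S] [DiffRing ι R]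
    [DiffRing ι S] (f : R →+* S) (hf : IsDiffHom ι f) (q : DiffSpec ι S) :
    DiffSpec ι (Localization.AtPrime q.1.asIdeal) →
      DiffSpec ι (Localization.AtPrime (DiffSpec.comap f hf q).1.asIdeal) :=
  DiffSpec.comap
    (Localization.localRingHom (DiffSpec.comap f hf q).1.asIdeal q.1.asIdeal f rfl)
    (isDiffHom_localRingHom f hf _ _ rfl)

/-! All three conditions say the same as `LiftsGeneralizations`: a differential prime below the
contraction of `q` is the contraction of a differential prime below `q`. Going-down iterates this,
and the local condition restates it, because differential primes of a local ring correspond to the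
differential primes below the given one.

Ordinary primes suffice throughout. In a `ℚ`-algebra the minimal primes over a differential ideal
are differential, so any prime over a differential prime can be shrunk to a differential one with
the same contraction (`DiffSpec.exists_le_comap_eq`).

The substantial implication is from lifting to openness. In a noetherian quasi-sober space, a set
stable under generalization is open once it contains, for each of its points, a nonempty open part
of that point's closure. For images of basic open sets, lifting gives the stability, and the local
condition is a Chevalley-type extension theorem,
`exists_ne_zero_forall_prime_exists_prime_of_shift`. There the derivatives of the generators are
well-ordered. Those transcendental over their predecessors form a polynomial ring `P` over which
everything is algebraic. By Dickson's lemma the others are derivatives of finitely many, and each of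
these has a separant that makes its proper derivatives polynomial in lower ones once inverted. A
valuation ring dominating a prime of `P` and containing finitely many prescribed elements therefore
contains all of `B`, and its centre on `B` is the required prime. -/

/-! ### Differential primes and the topology of the differential spectrum. -/

/-- In a `ℚ`-algebra, minimal primes over differential ideals are differential. -/
theorem IsDiffIdeal.of_mem_minimalPrimes {ι R : Type*} [CommRing R] [DiffRing ι R] [Algebra ℚ R]
    {I p : Ideal R} (hI : IsDiffIdeal ι I) (hp : p ∈ I.minimalPrimes) : IsDiffIdeal ι p := by
  intro i x hx
  have hprime : p.IsPrime := hp.1.1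
  obtain ⟨y, hy, n, hn⟩ : ∃ y ∉ p, ∃ n : ℕ, y * x ^ n ∈ I := by
    have : x ∈ (I.map (algebraMap R (Localization.AtPrime p))).radical.comap
        (algebraMap R (Localization.AtPrime p)) := by
      rw [IsLocalization.AtPrime.radical_map_of_mem_minimalPrimes _ p I hp]
      exact Ideal.mem_map_of_mem _ hx
    obtain ⟨n, hn⟩ := this
    rw [← map_pow, IsLocalization.algebraMap_mem_map_algebraMap_iff p.primeCompl] at hn
    obtain ⟨m, hm, h⟩ := hn
    exact ⟨m, hm, n, h⟩
  -- Differentiating trades one factor `x` for factors of its derivative; once no `x` is left,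
  -- primality gives the claim.
  have key : ∀ (k : ℕ) (s : R) (m : ℕ), s ∉ p → s * x ^ k * DiffRing.deriv i x ^ m ∈ I →
      DiffRing.deriv i x ∈ p := by
    intro k
    induction k with
    | zero =>
      intro s m hs h
      have h' := hp.1.2 h
      rw [pow_zero, mul_one] at h'
      exact hprime.mem_of_pow_mem _ ((hprime.mem_or_mem h').resolve_left hs)
    | succ k ih =>
      intro s m hs h
      have h1 := hI i _ h
      simp only [Derivation.leibniz, Derivation.leibniz_pow, smul_eq_mul, nsmul_eq_mul,
        Nat.add_sub_cancel] at h1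
      have h2 := Ideal.mul_mem_left I (s * DiffRing.deriv i x) h1
      have h3 := Ideal.mul_mem_left I (m * s * DiffRing.deriv i (DiffRing.deriv i x)) h
      have h4 := Ideal.mul_mem_left I (DiffRing.deriv i s * DiffRing.deriv i x) h
      have h5 : ((k + 1 : ℕ) : R) * (s ^ 2 * x ^ k * DiffRing.deriv i x ^ (m + 2)) ∈ I := by
        have := I.sub_mem (I.sub_mem h2 h3) h4
        convert this using 1
        -- The Leibniz rule produces the truncated exponent `m - 1`, so `m = 0` is separate.
        rcases m with _ | m
        · push_cast; ring
        · rw [Nat.add_sub_cancel]; push_cast; ring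
      have hu : IsUnit ((k + 1 : ℕ) : R) := by
        have : ((k + 1 : ℕ) : R) = algebraMap ℚ R ((k + 1 : ℕ) : ℚ) := by simp
        rw [this]
        exact (IsUnit.mk0 _ (by positivity)).map _
      exact ih (s ^ 2) (m + 2) (fun h => hs (hprime.mem_of_pow_mem _ h))
        ((Ideal.unit_mul_mem_iff_mem I hu).1 h5)
  exact key n y 0 hy (by simpa using hn)

theorem IsDiffIdeal.map {ι R S : Type*} [CommRing R] [CommRing S] [DiffRing ι R] [DiffRing ι S]
    {f : R →+* S} (hf : IsDiffHom ι f) {I : Ideal R} (hI : IsDiffIdeal ι I) :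
    IsDiffIdeal ι (I.map f) := by
  intro i x hx
  induction hx using Submodule.span_induction with
  | mem x hx =>
    obtain ⟨a, ha, rfl⟩ := hx
    rw [← hf i a]
    exact Ideal.mem_map_of_mem f (hI i a ha)
  | zero => simp
  | add x y _ _ hx hy => rw [map_add]; exact add_mem hx hy
  | smul a x hx h =>
    rw [smul_eq_mul, Derivation.leibniz]
    exact add_mem (Ideal.mul_mem_left _ _ h) (Ideal.mul_mem_right _ _ hx)

/-- A prime over a prime differential ideal contains a prime differential ideal with the same
contraction. -/
theorem DiffSpec.exists_le_comap_eq {ι R S : Type*} [CommRing R] [CommRing S] [DiffRing ι R]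
    [DiffRing ι S] [Algebra ℚ S] (f : R →+* S) (hf : IsDiffHom ι f) (p : DiffSpec ι R)
    (Q : Ideal S) [Q.IsPrime] (hQ : Q.comap f = p.1.asIdeal) :
    ∃ q : DiffSpec ι S, q.1.asIdeal ≤ Q ∧ DiffSpec.comap f hf q = p := by
  obtain ⟨P, hP, hPQ⟩ := Ideal.exists_minimalPrimes_le (I := p.1.asIdeal.map f) (J := Q)
    (Ideal.map_le_iff_le_comap.2 hQ.ge)
  refine ⟨⟨⟨P, hP.1.1⟩, (p.2.map hf).of_mem_minimalPrimes hP⟩, hPQ, ?_⟩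
  apply Subtype.ext
  apply PrimeSpectrum.ext
  exact le_antisymm ((Ideal.comap_mono hPQ).trans hQ.le) (Ideal.map_le_iff_le_comap.1 hP.1.2)

/-- The vanishing ideal of an irreducible closed set is prime, and it is differential as an
intersection of differential ideals, so it is the generic point. -/
instance DiffSpec.quasiSober {ι R : Type*} [CommRing R] [DiffRing ι R] :
    QuasiSober (DiffSpec ι R) := by
  refine ⟨fun {Z} hZ hZc => ?_⟩
  have hirr : IsIrreducible (Subtype.val '' Z : Set (PrimeSpectrum R)) :=
    hZ.image _ continuous_subtype_val.continuousOn
  have hprime := PrimeSpectrum.isIrreducible_iff_vanishingIdeal_isPrime.1 hirr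
  set I := PrimeSpectrum.vanishingIdeal (Subtype.val '' Z : Set (PrimeSpectrum R)) with hI
  have hdiff : IsDiffIdeal ι I := by
    intro i x hx
    rw [hI, PrimeSpectrum.mem_vanishingIdeal] at hx ⊢
    rintro _ ⟨p, hp, rfl⟩
    exact p.2 i x (hx p.1 ⟨p, hp, rfl⟩)
  refine ⟨⟨⟨I, hprime⟩, hdiff⟩, ?_⟩
  rw [isGenericPoint_def]
  have hcl : closure {(⟨I, hprime⟩ : PrimeSpectrum R)} = closure (Subtype.val '' Z) := by
    rw [PrimeSpectrum.closure_singleton, ← PrimeSpectrum.zeroLocus_vanishingIdeal_eq_closure]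
  have hind := Topology.IsInducing.subtypeVal (t := {p : PrimeSpectrum R | IsDiffIdeal ι p.asIdeal})
  refine (hind.closure_eq_preimage_closure_image _).trans ?_
  rw [Set.image_singleton, hcl]
  exact (hind.closure_eq_preimage_closure_image Z).symm.trans hZc.closure_eq

theorem DiffSpec.specializes_iff {ι R : Type*} [CommRing R] [DiffRing ι R] {p q : DiffSpec ι R} :
    p ⤳ q ↔ p ≤ q := by
  rw [subtype_specializes_iff, ← PrimeSpectrum.le_iff_specializes]
  rfl

/-! ### An openness criterion in noetherian spaces. -/

/-- In a noetherian sober space, a set stable under generalization that contains a neighbourhood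
of each of its points inside the closure of that point is open. -/
theorem TopologicalSpace.NoetherianSpace.isOpen_of_stableUnderGeneralization {X : Type*}
    [TopologicalSpace X] [TopologicalSpace.NoetherianSpace X] [QuasiSober X] {E : Set X}
    (hE : StableUnderGeneralization E)
    (h : ∀ x ∈ E, ∃ U : Set X, IsOpen U ∧ x ∈ U ∧ closure {x} ∩ U ⊆ E) : IsOpen E := by
  -- Noetherian induction on `Z`. A reducible `Z` splits into smaller pieces. If `Z` has generic
  -- point `x ∈ E`, only the smaller set `Z ∩ Uᶜ` matters; if `x ∉ E`, stability makes `Z` disjoint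
  -- from `E`.
  have key : ∀ Z : TopologicalSpace.Closeds X, IsClosed ((Z : Set X) ∩ Eᶜ) := by
    intro Z
    induction Z using WellFoundedLT.induction with
    | ind Z ih =>
      by_cases hZ : IsIrreducible (Z : Set X)
      · obtain ⟨x, hx⟩ := QuasiSober.sober hZ Z.isClosed
        by_cases hxE : x ∈ E
        · obtain ⟨U, hU, hxU, hUE⟩ := h x hxE
          rw [isGenericPoint_def] at hx
          have hlt : (⟨Z ∩ Uᶜ, Z.isClosed.inter hU.isClosed_compl⟩ :
              TopologicalSpace.Closeds X) < Z := by
            refine lt_of_le_of_ne (fun y hy => hy.1) fun heq => ?_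
            have hxZ : x ∈ Z := by
              rw [← SetLike.mem_coe, ← hx]; exact subset_closure rfl
            rw [← heq] at hxZ
            exact hxZ.2 hxU
          convert ih _ hlt using 1
          ext y
          simp only [TopologicalSpace.Closeds.coe_mk, Set.mem_inter_iff, Set.mem_compl_iff]
          constructor
          · rintro ⟨h1, h2⟩
            exact ⟨⟨h1, fun h3 => h2 (hUE ⟨hx.symm ▸ h1, h3⟩)⟩, h2⟩
          · rintro ⟨⟨h1, -⟩, h2⟩
            exact ⟨h1, h2⟩
        · rw [Set.inter_eq_left.2]
          · exact Z.isClosed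
          · intro y hy hyE
            exact hxE (hE (hx.specializes hy) hyE)
      · by_cases hne : (Z : Set X).Nonempty
        · rw [IsIrreducible, not_and, isPreirreducible_iff_isClosed_union_isClosed] at hZ
          have := hZ hne
          push Not at this
          obtain ⟨Z₁, Z₂, h1, h2, hsub, hn1, hn2⟩ := this
          have hlt : ∀ W : Set X, ∀ hW : IsClosed W, ¬ (Z : Set X) ⊆ W →
              (⟨Z ∩ W, Z.isClosed.inter hW⟩ : TopologicalSpace.Closeds X) < Z := by
            intro W hW hZW
            refine lt_of_le_of_ne (fun y hy => hy.1) fun heq => hZW fun y hy => ?_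
            rw [← heq] at hy
            exact hy.2
          convert (ih _ (hlt Z₁ h1 hn1)).union (ih _ (hlt Z₂ h2 hn2)) using 1
          ext y
          have := @hsub y
          simp only [TopologicalSpace.Closeds.coe_mk, Set.mem_inter_iff, Set.mem_compl_iff,
            Set.mem_union] at this ⊢
          tauto
        · rw [Set.not_nonempty_iff_eq_empty.1 hne, Set.empty_inter]
          exact isClosed_empty
  rw [← isClosed_compl_iff]
  simpa using key ⊤

/-! ### Dominating valuation rings. -/

/-- For a prime `p` of a subring `P` of a field there is a valuation ring dominating `P` at `p`. -/
theorem ValuationSubring.exists_dominating {P K : Type*} [CommRing P] [Field K] (f : P →+* K)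
    (hf : Function.Injective f) (p : Ideal P) [p.IsPrime] :
    ∃ V : ValuationSubring K, (∀ z, f z ∈ V) ∧ (∀ z ∉ p, (f z)⁻¹ ∈ V) ∧
      ∀ z ∈ p, f z ∈ V.nonunits := by
  have hunit : ∀ y : p.primeCompl, IsUnit (f y) := fun y => by
    rw [isUnit_iff_ne_zero, Ne, map_eq_zero_iff f hf]
    intro h
    exact y.2 (h ▸ p.zero_mem)
  set g : Localization.AtPrime p →+* K := IsLocalization.lift hunit with hg
  have hgf : ∀ z, g (algebraMap _ _ z) = f z := fun z => IsLocalization.lift_eq hunit z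
  obtain ⟨V, hV, hloc⟩ := IsLocalRing.exists_factor_valuationRing g
  refine ⟨V, fun z => ?_, fun z hz => ?_, fun z hz => ?_⟩
  · rw [← hgf]; exact hV _
  · have hu := IsLocalization.map_units (Localization.AtPrime p) (⟨z, hz⟩ : p.primeCompl)
    obtain ⟨w, hw⟩ := hu.exists_right_inv
    have : g w = (f z)⁻¹ := by
      rw [← hgf]
      refine eq_inv_of_mul_eq_one_right ?_
      rw [← map_mul, hw, map_one]
    rw [← this]; exact hV _
  · rw [← hgf]
    refine (ValuationSubring.coe_mem_nonunits_iff (a := ⟨g (algebraMap _ _ z), hV _⟩)).2 ?_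
    rw [IsLocalRing.mem_maximalIdeal]
    intro hu
    have h1 : IsUnit (algebraMap P (Localization.AtPrime p) z) := hloc.1 _ hu
    rw [IsLocalization.AtPrime.isUnit_to_map_iff (Localization.AtPrime p) p] at h1
    exact h1 hz

theorem ValuationSubring.mem_of_isIntegral_of_forall_mem {P K : Type*} [CommRing P] [Field K]
    [Algebra P K] (V : ValuationSubring K) (hV : ∀ z : P, algebraMap P K z ∈ V) {x : K}
    (hx : IsIntegral P x) : x ∈ V := by
  obtain ⟨q, hq, h⟩ := hx
  have hx' : IsIntegral V x := by
    refine ⟨q.map ((algebraMap P K).codRestrict V.toSubring hV), hq.map _, ?_⟩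
    rw [Polynomial.eval₂_map]
    exact h
  obtain ⟨y, rfl⟩ := IsIntegrallyClosed.isIntegral_iff.1 hx'
  exact y.2

/-- Let `P ⊆ B` be an algebraic extension of domains and `T` a finite subset of the fraction
field of `B`. Outside a hypersurface, each prime of `P` is dominated by a valuation ring
containing `T`. -/
theorem exists_ne_zero_forall_prime_exists_valuationSubring {P K : Type*} [CommRing P]
    [IsDomain P] [Field K] [Algebra P K] [FaithfulSMul P K] [Algebra.IsAlgebraic P K]
    (T : Finset K) :
    ∃ g : P, g ≠ 0 ∧ ∀ p : Ideal P, p.IsPrime → g ∉ p → ∃ V : ValuationSubring K,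
      (∀ z, algebraMap P K z ∈ V) ∧ (∀ z ∉ p, (algebraMap P K z)⁻¹ ∈ V) ∧
      (∀ z ∈ p, algebraMap P K z ∈ V.nonunits) ∧ ∀ t ∈ T, t ∈ V := by
  obtain ⟨g, hg, hT⟩ := Algebra.IsAlgebraic.exists_integral_multiples P T
  refine ⟨g, hg, fun p hp hgp => ?_⟩
  obtain ⟨V, h1, h2, h3⟩ := ValuationSubring.exists_dominating (algebraMap P K)
    (FaithfulSMul.algebraMap_injective P K) p
  refine ⟨V, h1, h2, h3, fun t ht => ?_⟩
  -- Write `t` as the inverse of `g` times the integral element `g • t`; both factors lie in `V`.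
  have h := V.mul_mem _ _ (h2 g hgp) (V.mem_of_isIntegral_of_forall_mem h1 (hT t ht))
  rwa [Algebra.smul_def, inv_mul_cancel_left₀] at h
  rw [Ne, map_eq_zero_iff _ (FaithfulSMul.algebraMap_injective P K)]
  exact hg

/-! ### Primes of polynomial rings. -/

/-- Extension of primes to a polynomial ring, avoiding a given nonzero polynomial. -/
theorem MvPolynomial.exists_ne_zero_forall_prime_exists_prime {σ A : Type*} [CommRing A]
    {g : MvPolynomial σ A} (hg : g ≠ 0) :
    ∃ a : A, a ≠ 0 ∧ ∀ p : Ideal A, p.IsPrime → a ∉ p →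
      ∃ P : Ideal (MvPolynomial σ A), P.IsPrime ∧ P.comap (algebraMap A _) = p ∧ g ∉ P := by
  obtain ⟨m, hm⟩ := MvPolynomial.ne_zero_iff.1 hg
  -- If one nonzero coefficient of `g` survives modulo `p`, then `g` is not in the kernel of
  -- reduction modulo `p`.
  refine ⟨g.coeff m, hm, fun p hp hap => ?_⟩
  refine ⟨RingHom.ker (MvPolynomial.map (σ := σ) (Ideal.Quotient.mk p)),
    RingHom.ker_isPrime _, ?_, ?_⟩
  · ext x
    simp [RingHom.mem_ker, MvPolynomial.algebraMap_eq, Ideal.Quotient.eq_zero_iff_mem]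
  · intro h
    rw [RingHom.mem_ker] at h
    have := congrArg (MvPolynomial.coeff m) h
    rw [MvPolynomial.coeff_map, MvPolynomial.coeff_zero, Ideal.Quotient.eq_zero_iff_mem] at this
    exact hap this

theorem AlgebraicIndependent.exists_ne_zero_forall_prime_exists_prime {σ A B : Type*} [CommRing A]
    [CommRing B] [Algebra A B] {y : σ → B} (hy : AlgebraicIndependent A y)
    {g : Algebra.adjoin A (Set.range y)} (hg : g ≠ 0) :
    ∃ a : A, a ≠ 0 ∧ ∀ p : Ideal A, p.IsPrime → a ∉ p →
      ∃ P : Ideal (Algebra.adjoin A (Set.range y)), P.IsPrime ∧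
        P.comap (algebraMap A _) = p ∧ g ∉ P := by
  obtain ⟨a, ha, h⟩ := MvPolynomial.exists_ne_zero_forall_prime_exists_prime
    (g := hy.aevalEquiv.symm g) (by simpa using hg)
  refine ⟨a, ha, fun p hp hap => ?_⟩
  obtain ⟨P, hP, hPp, hgP⟩ := h p hp hap
  refine ⟨P.comap hy.aevalEquiv.symm, inferInstance, ?_, hgP⟩
  ext x
  rw [← hPp]
  simp only [Ideal.mem_comap, AlgEquiv.commutes]

/-! ### Separants and algebraicity over the transcendental derivatives. -/

/-- An algebraic element over a domain of characteristic zero is a root of a polynomial with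
nonvanishing separant. -/
theorem IsAlgebraic.exists_aeval_derivative_ne_zero {S B : Type*} [CommRing S] [IsDomain S]
    [CharZero S] [CommRing B] [Algebra S B] [FaithfulSMul S B] {z : B} (hz : IsAlgebraic S z) :
    ∃ p : Polynomial S, Polynomial.aeval z p = 0 ∧
      Polynomial.aeval z (Polynomial.derivative p) ≠ 0 := by
  obtain ⟨p, hp, h⟩ := hz
  -- Take the derivative of `p` as the new polynomial while it vanishes at `z`; characteristic zero
  -- keeps it nonzero.
  induction hn : p.natDegree using Nat.strong_induction_on generalizing p with
  | _ n ih =>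
    by_cases h' : Polynomial.aeval z (Polynomial.derivative p) = 0
    · have hdeg : p.natDegree ≠ 0 := by
        intro h0
        rw [Polynomial.eq_C_of_natDegree_eq_zero h0] at h hp
        rw [Polynomial.aeval_C, map_eq_zero_iff _ (FaithfulSMul.algebraMap_injective S B)] at h
        exact hp (by rw [h, Polynomial.C_0])
      refine ih _ (hn ▸ Polynomial.natDegree_derivative_lt hdeg) _ (fun h0 => hdeg ?_) h' rfl
      exact Polynomial.derivative_eq_zero.1 h0
    · exact ⟨p, h, h'⟩

/-- A family indexed by a linear order is algebraically independent as soon as each member is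
transcendental over the previous ones. -/
theorem algebraicIndependent_of_forall_transcendental_adjoin_Iio {D A B : Type*} [LinearOrder D]
    [CommRing A] [CommRing B] [Algebra A B]
    (hinj : Function.Injective (algebraMap A B)) (x : D → B) (s : Set D)
    (h : ∀ d ∈ s, Transcendental (Algebra.adjoin A (x '' Set.Iio d)) (x d)) :
    AlgebraicIndependent A fun d : s => x d := by
  classical
  refine algebraicIndependent_of_finite_type fun t ht => ?_
  lift t to Finset s using ht
  induction t using Finset.induction_on_max with
  | empty =>
    have : IsEmpty ((∅ : Finset s) : Set s) := by simp
    exact algebraicIndependent_empty_type_iff.2 hinj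
  | insert a t hmax ih =>
    rw [Finset.coe_insert]
    refine AlgebraicIndepOn.insert (x := fun d : s => x d) ih ?_
    refine (h a a.2).of_tower_top_of_subalgebra_le (Algebra.adjoin_mono ?_)
    rintro _ ⟨d, hd, rfl⟩
    exact ⟨d, hmax d hd, rfl⟩

theorem Derivation.mem_adjoin_image {D A B : Type*} [CommRing A] [CommRing B] [Algebra A B]
    {δ : Derivation ℤ B B} (hδ : ∀ a : A, δ (algebraMap A B a) ∈ Set.range (algebraMap A B))
    {x : D → B} {shift : D → D} (hx : ∀ d, δ (x d) = x (shift d)) {s t : Set D} (hst : s ⊆ t)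
    (hs : ∀ d ∈ s, shift d ∈ t) {z : B} (hz : z ∈ Algebra.adjoin A (x '' s)) :
    δ z ∈ Algebra.adjoin A (x '' t) := by
  have hle : Algebra.adjoin A (x '' s) ≤ Algebra.adjoin A (x '' t) :=
    Algebra.adjoin_mono (Set.image_mono hst)
  induction hz using Algebra.adjoin_induction with
  | mem z hz =>
    obtain ⟨d, hd, rfl⟩ := hz
    rw [hx]
    exact Algebra.subset_adjoin ⟨_, hs d hd, rfl⟩
  | algebraMap a =>
    obtain ⟨b, hb⟩ := hδ a
    rw [← hb]
    exact Subalgebra.algebraMap_mem _ b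
  | add y z _ _ hy hz => rw [map_add]; exact add_mem hy hz
  | mul y z hy' hz' hy hz =>
    rw [Derivation.leibniz]
    exact add_mem (mul_mem (hle hy') hz) (mul_mem (hle hz') hy)

theorem Subalgebra.aeval_mem_of_le {A B : Type*} [CommRing A] [CommRing B] [Algebra A B]
    {S T : Subalgebra A B} (hST : S ≤ T) {z : B} (hz : z ∈ T) (p : Polynomial S) :
    Polynomial.aeval z p ∈ T := by
  rw [Polynomial.aeval_eq_sum_range]
  exact sum_mem fun i _ => mul_mem (hST (p.coeff i).2) (pow_mem hz i)

/-- By the chain rule the difference is the value at `z` of `p` with its coefficients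
differentiated. -/
theorem Derivation.aeval_sub_mem {A B : Type*} [CommRing A] [CommRing B] [Algebra A B]
    {S T : Subalgebra A B} (δ : Derivation ℤ B B) (hδ : ∀ y ∈ S, δ y ∈ T) {z : B}
    (hz : z ∈ T) (p : Polynomial S) :
    δ (Polynomial.aeval z p) - Polynomial.aeval z (Polynomial.derivative p) * δ z ∈ T := by
  induction p using Polynomial.induction_on' with
  | add p q hp hq =>
    simp only [map_add]
    convert add_mem hp hq using 1
    ring
  | monomial n a =>
    have h : δ (Polynomial.aeval z (Polynomial.monomial n a)) -
        Polynomial.aeval z (Polynomial.derivative (Polynomial.monomial n a)) * δ z =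
          δ (a : B) * z ^ n := by
      simp only [Polynomial.derivative_monomial, Polynomial.aeval_monomial, map_mul,
        Derivation.leibniz, Derivation.leibniz_pow, smul_eq_mul, nsmul_eq_mul,
        Subalgebra.algebraMap_def, Algebra.algebraMap_self, RingHom.id_apply]
      push_cast
      ring
    rw [h]
    exact mul_mem (hδ a a.2) (pow_mem hz n)

/-- If `x k` is algebraic over the lower derivatives, then all proper derivatives of `x k` become
polynomials in lower derivatives after inverting a single element, the separant. -/
theorem exists_separant {ι D A B : Type*} [LinearOrder D] [CommRing A] [CommRing B] [IsDomain B]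
    [CharZero B] [Algebra A B] {δ : ι → Derivation ℤ B B}
    (hδ : ∀ i, ∀ a : A, δ i (algebraMap A B a) ∈ Set.range (algebraMap A B))
    {x : D → B} {shift : ι → D → D} (hx : ∀ i d, δ i (x d) = x (shift i d))
    (hmono : ∀ i, StrictMono (shift i)) (hlt : ∀ i d, d < shift i d) {k : D}
    (hk : IsAlgebraic (Algebra.adjoin A (x '' Set.Iio k)) (x k)) :
    ∃ S : B, S ≠ 0 ∧ ∀ d, Relation.TransGen (fun a b => ∃ i, b = shift i a) k d →
      S * x d ∈ Algebra.adjoin A (x '' Set.Iio d) := by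
  obtain ⟨p, hp, hp'⟩ := hk.exists_aeval_derivative_ne_zero
  have hmem : ∀ {c d : D}, c < d → x c ∈ Algebra.adjoin A (x '' Set.Iio d) := fun h =>
    Algebra.subset_adjoin ⟨_, h, rfl⟩
  have hle : ∀ {s t : Set D}, s ⊆ t → Algebra.adjoin A (x '' s) ≤ Algebra.adjoin A (x '' t) :=
    fun h => Algebra.adjoin_mono (Set.image_mono h)
  have hS : Polynomial.aeval (x k) (Polynomial.derivative p) ∈
      Algebra.adjoin A (x '' Set.Iic k) :=
    Subalgebra.aeval_mem_of_le (hle Set.Iio_subset_Iic_self)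
      (Algebra.subset_adjoin ⟨k, Set.self_mem_Iic, rfl⟩) _
  refine ⟨_, hp', fun d hd => ?_⟩
  -- The inequality is carried along so that, at later steps, the derivative of the separant
  -- involves only indices below the new one.
  suffices k < d ∧ Polynomial.aeval (x k) (Polynomial.derivative p) * x d ∈
    Algebra.adjoin A (x '' Set.Iio d) from this.2
  induction hd with
  | single h =>
    obtain ⟨i, rfl⟩ := h
    refine ⟨hlt i k, ?_⟩
    have h := (δ i).aeval_sub_mem
      (fun y hy => (δ i).mem_adjoin_image (hδ i) (hx i) (Set.Iio_subset_Iio (hlt i k).le)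
        (fun d hd => hmono i hd) hy) (hmem (hlt i k)) p
    rw [hp, map_zero, zero_sub, hx] at h
    exact neg_mem_iff.1 h
  | @tail c d _ h ih =>
    obtain ⟨i, rfl⟩ := h
    obtain ⟨hkc, ih⟩ := ih
    refine ⟨hkc.trans (hlt i c), ?_⟩
    have h1 := (δ i).mem_adjoin_image (hδ i) (hx i) (Set.Iio_subset_Iio (hlt i c).le)
      (fun d hd => hmono i hd) ih
    have h2 := (δ i).mem_adjoin_image (t := Set.Iio (shift i c)) (hδ i) (hx i)
      (fun d hd => (lt_of_le_of_lt hd hkc).trans (hlt i c))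
      (fun d hd => hmono i (lt_of_le_of_lt hd hkc)) hS
    -- Differentiating `S * x c` gives `S * x (shift i c)` plus a term in lower derivatives, so the
    -- same separant `S` serves again.
    rw [Derivation.leibniz, hx, smul_eq_mul, smul_eq_mul] at h1
    convert sub_mem h1 (mul_mem (hmem (hlt i c)) h2) using 1
    ring

/-- By well-founded induction, each `x d` outside `s` is algebraic over elements already algebraic
over the adjoined ring, so transitivity applies. -/
theorem Algebra.isAlgebraic_adjoin_of_forall {D A B : Type*} [LinearOrder D] [WellFoundedLT D]
    [CommRing A] [CommRing B] [IsDomain B] [Algebra A B] (x : D → B)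
    (hgen : Algebra.adjoin A (Set.range x) = ⊤) (s : Set D)
    (hs : ∀ d ∉ s, IsAlgebraic (Algebra.adjoin A (x '' Set.Iio d)) (x d)) :
    Algebra.IsAlgebraic (Algebra.adjoin A (x '' s)) B := by
  set P := Algebra.adjoin A (x '' s) with hP
  set C := Subalgebra.algebraicClosure P B with hC
  have hx : ∀ d, x d ∈ C := by
    intro d
    induction d using WellFoundedLT.induction with
    | ind d ih =>
      by_cases hd : d ∈ s
      · exact C.algebraMap_mem (⟨x d, Algebra.subset_adjoin ⟨d, hd, rfl⟩⟩ : P)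
      · have hle : Algebra.adjoin A (x '' Set.Iio d) ≤ C.restrictScalars A := by
          refine Algebra.adjoin_le ?_
          rintro _ ⟨e, he, rfl⟩
          exact ih e he
        have h1 : IsAlgebraic (C.restrictScalars A) (x d) := by
          by_contra hcon
          exact Transcendental.of_tower_top_of_subalgebra_le hle hcon (hs d hd)
        have h2 : IsAlgebraic C (x d) := h1
        exact h2.restrictScalars P
  have htop : (⊤ : Subalgebra A B) ≤ C.restrictScalars A := by
    rw [← hgen]
    refine Algebra.adjoin_le ?_
    rintro _ ⟨d, rfl⟩
    exact hx d
  exact ⟨fun b => htop (Algebra.mem_top (R := A))⟩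

/-- Extension of primes for differentially finitely generated extensions of domains, in terms of
a well-ordered family of derivatives generating the extension. -/
theorem exists_ne_zero_forall_prime_exists_prime_of_shift {ι D A B : Type*} [LinearOrder D]
    [WellFoundedLT D] [CommRing A] [CommRing B] [IsDomain B] [CharZero B] [Algebra A B]
    (hinj : Function.Injective (algebraMap A B)) {δ : ι → Derivation ℤ B B}
    (hδ : ∀ i, ∀ a : A, δ i (algebraMap A B a) ∈ Set.range (algebraMap A B))
    {x : D → B} {shift : ι → D → D} (hx : ∀ i d, δ i (x d) = x (shift i d))
    (hmono : ∀ i, StrictMono (shift i)) (hlt : ∀ i d, d < shift i d)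
    (hfin : ∀ s : Set D, ∃ F : Finset D, (F : Set D) ⊆ s ∧ ∀ d ∈ s, ∃ k ∈ F,
      Relation.ReflTransGen (fun a b => ∃ i, b = shift i a) k d)
    (hgen : Algebra.adjoin A (Set.range x) = ⊤) {b : B} (hb : b ≠ 0) :
    ∃ a : A, a ≠ 0 ∧ ∀ p : Ideal A, p.IsPrime → a ∉ p →
      ∃ Q : Ideal B, Q.IsPrime ∧ Q.comap (algebraMap A B) = p ∧ b ∉ Q := by
  classical
  set s : Set D := {d | ¬ IsAlgebraic (Algebra.adjoin A (x '' Set.Iio d)) (x d)} with hs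
  obtain ⟨F, hF, hFs⟩ := hfin sᶜ
  have hsep : ∀ k : F, ∃ S : B, S ≠ 0 ∧ ∀ d,
      Relation.TransGen (fun a b => ∃ i, b = shift i a) (k : D) d →
        S * x d ∈ Algebra.adjoin A (x '' Set.Iio d) := fun k =>
    exists_separant hδ hx hmono hlt (not_not.1 (hF k.2))
  choose S hS0 hS using hsep
  have hy : AlgebraicIndependent A fun d : s => x d :=
    algebraicIndependent_of_forall_transcendental_adjoin_Iio hinj x s fun d hd => hd
  have hrange : x '' s = Set.range fun d : s => x d := by
    rw [Set.image_eq_range]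
  have halg : Algebra.IsAlgebraic (Algebra.adjoin A (Set.range fun d : s => x d)) B := by
    rw [← hrange]
    exact Algebra.isAlgebraic_adjoin_of_forall x hgen s fun d hd => not_not.1 hd
  set P := Algebra.adjoin A (Set.range fun d : s => x d) with hP
  let K := FractionRing B
  have hK : Algebra.IsAlgebraic P K := by
    have : Algebra.IsAlgebraic B K := IsLocalization.isAlgebraic _ (nonZeroDivisors B)
    exact Algebra.IsAlgebraic.trans P B K
  have hBK : Function.Injective (algebraMap B K) := IsFractionRing.injective B K
  -- The inverse of `b` keeps `b` out of the centre, the `x d` with `d ∈ F` start the induction, and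
  -- the inverse separants carry it to their proper derivatives.
  obtain ⟨g, hg, hV⟩ := exists_ne_zero_forall_prime_exists_valuationSubring (P := P) (K := K)
    (insert (algebraMap B K b)⁻¹ (F.image (fun d => algebraMap B K (x d)) ∪
      Finset.univ.image fun k => (algebraMap B K (S k))⁻¹))
  obtain ⟨a, ha, hA⟩ := hy.exists_ne_zero_forall_prime_exists_prime hg
  refine ⟨a, ha, fun p hp hap => ?_⟩
  obtain ⟨P', hP', hP'p, hgP'⟩ := hA p hp hap
  obtain ⟨V, hV1, hV2, hV3, hV4⟩ := hV P' hP' hgP'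
  have hAV : ∀ a : A, algebraMap B K (algebraMap A B a) ∈ V := fun a => hV1 (algebraMap A P a)
  have hmemV : ∀ t : Set D, (∀ d ∈ t, algebraMap B K (x d) ∈ V) →
      ∀ z ∈ Algebra.adjoin A (x '' t), algebraMap B K z ∈ V := by
    intro t ht z hz
    induction hz using Algebra.adjoin_induction with
    | mem z hz => obtain ⟨d, hd, rfl⟩ := hz; exact ht d hd
    | algebraMap a => exact hAV a
    | add y z _ _ hy hz => rw [map_add]; exact V.add_mem _ _ hy hz
    | mul y z _ _ hy hz => rw [map_mul]; exact V.mul_mem _ _ hy hz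
  have hxV : ∀ d, algebraMap B K (x d) ∈ V := by
    intro d
    induction d using WellFoundedLT.induction with
    | ind d ih =>
      by_cases hd : d ∈ s
      · exact hV1 ⟨x d, Algebra.subset_adjoin ⟨⟨d, hd⟩, rfl⟩⟩
      · obtain ⟨k, hk, hkd⟩ := hFs d hd
        rcases Relation.reflTransGen_iff_eq_or_transGen.1 hkd with rfl | hkd
        · refine hV4 _ (Finset.mem_insert_of_mem (Finset.mem_union_left _ ?_))
          exact Finset.mem_image_of_mem _ hk
        · have h1 := hmemV _ (fun e he => ih e he) _ (hS ⟨k, hk⟩ d hkd)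
          have h2 : (algebraMap B K (S ⟨k, hk⟩))⁻¹ ∈ V :=
            hV4 _ (Finset.mem_insert_of_mem (Finset.mem_union_right _
              (Finset.mem_image_of_mem _ (Finset.mem_univ _))))
          have h3 := V.mul_mem _ _ h2 h1
          rwa [map_mul, inv_mul_cancel_left₀] at h3
          rw [Ne, map_eq_zero_iff _ hBK]
          exact hS0 _
  have hBV : ∀ z : B, algebraMap B K z ∈ V.toSubring := fun z =>
    hmemV Set.univ (fun d _ => hxV d) z (by rw [Set.image_univ, hgen]; exact Algebra.mem_top)
  refine ⟨(IsLocalRing.maximalIdeal V).comap ((algebraMap B K).codRestrict V.toSubring hBV),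
    Ideal.comap_isPrime _ _, ?_, ?_⟩
  · ext c
    have hc : algebraMap B K (algebraMap A B c) = algebraMap P K (algebraMap A P c) := rfl
    have h0 : c ∈ p ↔ algebraMap A P c ∈ P' := by rw [← hP'p, Ideal.mem_comap]
    rw [h0, Ideal.mem_comap, Ideal.mem_comap, ← ValuationSubring.coe_mem_nonunits_iff]
    change algebraMap B K (algebraMap A B c) ∈ V.nonunits ↔ _
    rw [hc]
    -- Elements of `P` outside `P'` have inverses in `V`, so the centre of `V` on `P` is exactly
    -- `P'`.
    refine ⟨fun h => ?_, hV3 _⟩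
    by_contra hcon
    have h1 := hV2 _ hcon
    rcases V.mem_nonunits_iff_or.1 h with h2 | h2
    · rw [map_eq_zero_iff _ (FaithfulSMul.algebraMap_injective P K)] at h2
      exact hcon (h2 ▸ P'.zero_mem)
    · exact h2 h1
  · intro h
    rw [Ideal.mem_comap, ← ValuationSubring.coe_mem_nonunits_iff] at h
    rcases V.mem_nonunits_iff_or.1 h with h2 | h2
    · exact hb ((map_eq_zero_iff _ hBK).1 h2)
    · exact h2 (hV4 _ (Finset.mem_insert_self _ _))

/-! ### Multi-indexed derivatives and Dickson's lemma. -/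

open scoped IsMulCommutative in
/-- Iterated derivatives indexed by multi-indices. -/
theorem DiffRing.exists_iterated_deriv (ι R : Type*) [CommRing R] [DiffRing ι R] :
    ∃ θ : (ι →₀ ℕ) → R → R, (∀ z, θ 0 z = z) ∧
      ∀ i e z, DiffRing.deriv i (θ e z) = θ (e + Finsupp.single i 1) z := by
  let y : ι → Module.End ℤ R := fun i => (DiffRing.deriv i : Derivation ℤ R R).toLinearMap
  have hcomm : ∀ a ∈ Set.range y, ∀ b ∈ Set.range y, a * b = b * a := by
    rintro _ ⟨i, rfl⟩ _ ⟨j, rfl⟩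
    ext z
    exact DiffRing.deriv_comm i j z
  -- Products over multi-indices need a commutative monoid, which the subalgebra generated by the
  -- commuting operators supplies.
  have := Algebra.isMulCommutative_adjoin ℤ hcomm
  let Y : ι → Algebra.adjoin ℤ (Set.range y) := fun i => ⟨y i, Algebra.subset_adjoin ⟨i, rfl⟩⟩
  refine ⟨fun e z => ((e.prod fun i n => Y i ^ n : Algebra.adjoin ℤ (Set.range y)) :
    Module.End ℤ R) z, fun z => by simp, fun i e z => ?_⟩
  have h : ((Finsupp.single i 1).prod fun i n => Y i ^ n) = Y i := by
    rw [Finsupp.prod_single_index (h := fun i n => Y i ^ n) (pow_zero (Y i)), pow_one]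
  dsimp only
  rw [add_comm, Finsupp.prod_add_index' (h := fun i n => Y i ^ n) (fun _ => pow_zero _)
    (fun _ _ _ => pow_add _ _ _), h]
  rfl

/-- The operators on the index set of derivatives of finitely many differential indeterminates. -/
noncomputable def derivShift {ι τ : Type*} (i : ι) (d : τ ×ₗ Lex (ι →₀ ℕ)) : τ ×ₗ Lex (ι →₀ ℕ) :=
  toLex ((ofLex d).1, toLex (ofLex (ofLex d).2 + Finsupp.single i 1))

theorem derivShift_strictMono {ι τ : Type*} [LinearOrder ι] [LinearOrder τ] (i : ι) :
    StrictMono (derivShift i : τ ×ₗ Lex (ι →₀ ℕ) → τ ×ₗ Lex (ι →₀ ℕ)) := by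
  intro c d h
  rw [Prod.Lex.lt_iff] at h ⊢
  refine h.imp id fun h => ⟨h.1, ?_⟩
  exact add_lt_add_left h.2 (toLex (Finsupp.single i 1))

theorem lt_derivShift {ι τ : Type*} [LinearOrder ι] [LinearOrder τ] (i : ι)
    (d : τ ×ₗ Lex (ι →₀ ℕ)) : d < derivShift i d := by
  rw [Prod.Lex.lt_iff]
  refine Or.inr ⟨rfl, ?_⟩
  refine lt_of_le_of_ne (Finsupp.toLex_monotone (le_self_add)) fun h => ?_
  have := congrArg (fun e : Lex (ι →₀ ℕ) => ofLex e i) h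
  simp [derivShift] at this

theorem reflTransGen_derivShift {ι τ : Type*} (t : τ) (c : ι →₀ ℕ) : ∀ m : ι →₀ ℕ,
    Relation.ReflTransGen (fun a b : τ ×ₗ Lex (ι →₀ ℕ) => ∃ i, b = derivShift i a)
      (toLex (t, toLex m)) (toLex (t, toLex (m + c))) := by
  induction c using Finsupp.induction_linear with
  | zero => intro m; rw [add_zero]
  | add c c' hc hc' => intro m; rw [← add_assoc]; exact (hc m).trans (hc' _)
  | single i n =>
    intro m
    induction n with
    | zero => rw [Finsupp.single_zero, add_zero]
    | succ n ih =>
      refine ih.tail ⟨i, ?_⟩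
      rw [Finsupp.single_add, ← add_assoc]
      rfl

/-- Dickson's lemma for derivatives. -/
theorem exists_finset_reflTransGen_derivShift {ι τ : Type*} [Finite ι] [Finite τ]
    (s : Set (τ ×ₗ Lex (ι →₀ ℕ))) :
    ∃ F : Finset (τ ×ₗ Lex (ι →₀ ℕ)), (F : Set (τ ×ₗ Lex (ι →₀ ℕ))) ⊆ s ∧ ∀ d ∈ s, ∃ k ∈ F,
      Relation.ReflTransGen (fun a b => ∃ i, b = derivShift i a) k d := by
  let f : τ → (ι →₀ ℕ) → τ ×ₗ Lex (ι →₀ ℕ) := fun t m => toLex (t, toLex m)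
  have hfin : (⋃ t, f t '' {m | Minimal (fun m => f t m ∈ s) m}).Finite := by
    refine Set.finite_iUnion fun t => Set.Finite.image _ ?_
    exact WellQuasiOrderedLE.finite_of_isAntichain (setOfPred_minimal_antichain _)
  refine ⟨hfin.toFinset, ?_, fun d hd => ?_⟩
  · intro d hd
    rw [Set.Finite.coe_toFinset, Set.mem_iUnion] at hd
    obtain ⟨t, m, hm, rfl⟩ := hd
    exact (show Minimal (fun m => f t m ∈ s) m from hm).prop
  · obtain ⟨m, hm, hmin⟩ := exists_minimal_le_of_wellFoundedLT
      (fun m => f (ofLex d).1 m ∈ s) (ofLex (ofLex d).2) hd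
    refine ⟨f (ofLex d).1 m, ?_, ?_⟩
    · rw [Set.Finite.mem_toFinset, Set.mem_iUnion]
      exact ⟨_, m, hmin, rfl⟩
    · obtain ⟨c, hc⟩ := exists_add_of_le hm
      have := reflTransGen_derivShift (ofLex d).1 c m
      rwa [← hc] at this

/-! ### Extension of primes for differentially finitely generated algebras. -/

/-- The derivation induced on the quotient by a stable ideal. -/
def Derivation.quotient {R : Type*} [CommRing R] (D : Derivation ℤ R R) (I : Ideal R)
    (h : ∀ x ∈ I, D x ∈ I) : Derivation ℤ (R ⧸ I) (R ⧸ I) :=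
  Derivation.mk'
    (QuotientAddGroup.map I.toAddSubgroup I.toAddSubgroup
      (D : R →ₗ[ℤ] R).toAddMonoidHom h : R ⧸ I →+ R ⧸ I).toIntLinearMap <| by
    intro a b
    obtain ⟨a, rfl⟩ := Ideal.Quotient.mk_surjective a
    obtain ⟨b, rfl⟩ := Ideal.Quotient.mk_surjective b
    change Ideal.Quotient.mk I (D (a * b)) = Ideal.Quotient.mk I (a * D b + b * D a)
    rw [Derivation.leibniz, smul_eq_mul, smul_eq_mul]

theorem DiffAlgebra.deriv_algebraMap {ι A B : Type*} [CommRing A] [CommRing B] [DiffRing ι A]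
    [DiffRing ι B] [Algebra A B] [DiffAlgebra ι A B] (i : ι) (a : A) :
    DiffRing.deriv i (algebraMap A B a) = algebraMap A B (DiffRing.deriv i a) :=
  (DiffAlgebra.isDiffHom_algebraMap (ι := ι) (A := A) (B := B) i a).symm

/-- A differentially finitely generated algebra is generated as an algebra by the derivatives of
finitely many elements. -/
theorem DiffFiniteType.exists_adjoin_eq_top {ι A B : Type*} [CommRing A] [CommRing B]
    [DiffRing ι A] [DiffRing ι B] [Algebra A B] [DiffAlgebra ι A B] (hB : DiffFiniteType ι A B) :
    ∃ (n : ℕ) (x : Fin n ×ₗ Lex (ι →₀ ℕ) → B),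
      (∀ i d, DiffRing.deriv i (x d) = x (derivShift i d)) ∧
      Algebra.adjoin A (Set.range x) = ⊤ := by
  obtain ⟨s, hs⟩ := hB
  obtain ⟨θ, hθ0, hθ⟩ := DiffRing.exists_iterated_deriv ι B
  let x : Fin s.card ×ₗ Lex (ι →₀ ℕ) → B := fun d =>
    θ (ofLex (ofLex d).2) (s.equivFin.symm (ofLex d).1 : s)
  have hx : ∀ i d, DiffRing.deriv i (x d) = x (derivShift i d) := fun i d => hθ i _ _
  refine ⟨s.card, x, hx, ?_⟩
  rw [eq_top_iff, ← hs]
  refine sInf_le ⟨fun z hz => ?_, fun i z hz => ?_⟩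
  · refine Algebra.subset_adjoin ⟨toLex (s.equivFin ⟨z, hz⟩, toLex 0), ?_⟩
    simp [x, hθ0]
  · rw [← Set.image_univ] at hz ⊢
    exact (DiffRing.deriv i : Derivation ℤ B B).mem_adjoin_image
      (fun a => ⟨_, (DiffAlgebra.deriv_algebraMap i a).symm⟩) (hx i) subset_rfl
      (fun _ _ => Set.mem_univ _) hz

/-- Extension of primes for differentially finitely generated algebras: near the contraction of
`q`, inside its closure, every prime lifts to a prime not containing a given `b ∉ q`. -/
theorem DiffFiniteType.exists_notMem_forall_prime_exists_prime {ι A B : Type*} [Finite ι]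
    [CommRing A] [CommRing B] [DiffRing ι A] [DiffRing ι B] [Algebra ℚ B] [Algebra A B]
    [DiffAlgebra ι A B] (hB : DiffFiniteType ι A B) (q : Ideal B) [q.IsPrime]
    (hq : IsDiffIdeal ι q) {b : B} (hb : b ∉ q) :
    ∃ a : A, algebraMap A B a ∉ q ∧ ∀ p : Ideal A, p.IsPrime → q.comap (algebraMap A B) ≤ p →
      a ∉ p → ∃ Q : Ideal B, Q.IsPrime ∧ Q.comap (algebraMap A B) = p ∧ b ∉ Q := by
  obtain ⟨n, x, hx, hgen⟩ := hB.exists_adjoin_eq_top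
  let p₀ : Ideal A := q.under A
  have : CharZero (B ⧸ q) := algebraRat.charZero _
  -- Any linear order on `ι` will do; it only serves to order the multi-indices lexicographically.
  obtain ⟨N, ⟨e⟩⟩ := Finite.exists_equiv_fin ι
  let _ : LinearOrder ι := LinearOrder.lift' e e.injective
  have hstable : ∀ i, ∀ x ∈ q, (DiffRing.deriv i : Derivation ℤ B B) x ∈ q := hq
  have hmk : ∀ a : A, algebraMap (A ⧸ p₀) (B ⧸ q) (Ideal.Quotient.mk p₀ a) =
      Ideal.Quotient.mk q (algebraMap A B a) := fun a => rfl
  have hgen' : Algebra.adjoin (A ⧸ p₀)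
      (Set.range fun d => Ideal.Quotient.mk q (x d)) = ⊤ := by
    rw [eq_top_iff]
    intro z _
    obtain ⟨z, rfl⟩ := Ideal.Quotient.mk_surjective z
    have hz : z ∈ Algebra.adjoin A (Set.range x) := hgen ▸ Algebra.mem_top
    induction hz using Algebra.adjoin_induction with
    | mem z hz => obtain ⟨d, rfl⟩ := hz; exact Algebra.subset_adjoin ⟨d, rfl⟩
    | algebraMap a => rw [← hmk]; exact Subalgebra.algebraMap_mem _ _
    | add y z _ _ hy hz => rw [map_add]; exact add_mem (hy trivial) (hz trivial)
    | mul y z _ _ hy hz => rw [map_mul]; exact mul_mem (hy trivial) (hz trivial)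
  obtain ⟨a, ha, h⟩ := exists_ne_zero_forall_prime_exists_prime_of_shift
    (A := A ⧸ p₀) (B := B ⧸ q) (FaithfulSMul.algebraMap_injective _ _)
    (δ := fun i => (DiffRing.deriv i).quotient q (hstable i))
    (fun i a => by
      obtain ⟨a, rfl⟩ := Ideal.Quotient.mk_surjective a
      refine ⟨Ideal.Quotient.mk p₀ (DiffRing.deriv i a), ?_⟩
      exact congrArg (Ideal.Quotient.mk q) (DiffAlgebra.deriv_algebraMap i a).symm)
    (x := fun d => Ideal.Quotient.mk q (x d)) (shift := derivShift)
    (fun i d => congrArg (Ideal.Quotient.mk q) (hx i d))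
    derivShift_strictMono lt_derivShift exists_finset_reflTransGen_derivShift hgen'
    (b := Ideal.Quotient.mk q b) (by rwa [Ne, Ideal.Quotient.eq_zero_iff_mem])
  obtain ⟨a, rfl⟩ := Ideal.Quotient.mk_surjective a
  refine ⟨a, fun h' => ha (Ideal.Quotient.eq_zero_iff_mem.2 h'), fun p hp hle hap => ?_⟩
  have hcomap : (p.map (Ideal.Quotient.mk p₀)).comap (Ideal.Quotient.mk p₀) = p := by
    rw [Ideal.comap_map_of_surjective _ Ideal.Quotient.mk_surjective, sup_eq_left,
      ← RingHom.ker_eq_comap_bot, Ideal.mk_ker]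
    exact hle
  obtain ⟨Q, hQ, hQp, hbQ⟩ := h (p.map (Ideal.Quotient.mk p₀))
    (Ideal.map_isPrime_of_surjective Ideal.Quotient.mk_surjective (by rwa [Ideal.mk_ker]))
    (fun h' => hap (by rw [← hcomap]; exact h'))
  refine ⟨Q.comap (Ideal.Quotient.mk q), inferInstance, ?_, hbQ⟩
  rw [← hcomap, ← hQp]
  rfl

/-! ### Lifting generalizations and its equivalent forms. -/

/-- Generalizations of contractions lift along the contraction map. -/
def LiftsGeneralizations {ι R S : Type*} [CommRing R] [CommRing S] [DiffRing ι R] [DiffRing ι S]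
    (f : R →+* S) (hf : IsDiffHom ι f) : Prop :=
  ∀ (q : DiffSpec ι S) (p : DiffSpec ι R), p ≤ DiffSpec.comap f hf q →
    ∃ q' ≤ q, DiffSpec.comap f hf q' = p

section

variable {ι R S : Type*} [CommRing R] [CommRing S] [DiffRing ι R] [DiffRing ι S]
  {f : R →+* S} {hf : IsDiffHom ι f}

theorem HasDiffGoingDown.liftsGeneralizations (h : HasDiffGoingDown f hf) :
    LiftsGeneralizations f hf := by
  intro q p hp
  obtain ⟨q', hq', hq, hqp⟩ := h 1 2 le_rfl one_lt_two ![DiffSpec.comap f hf q, p] ![q]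
    (by
      intro i j hij
      fin_cases i <;> fin_cases j
      · exact le_rfl
      · exact hp
      · exact absurd hij (by decide)
      · exact le_rfl)
    (fun i j _ => by rw [Subsingleton.elim i j]) (fun i => by fin_cases i; rfl)
  refine ⟨q' 1, ?_, hqp 1⟩
  have h0 : q' 0 = q := hq 0
  rw [← h0]
  exact hq' (by decide)

theorem LiftsGeneralizations.exists_antitone_extension (h : LiftsGeneralizations f hf) {n : ℕ}
    {p : Fin (n + 2) → DiffSpec ι R} {q : Fin (n + 1) → DiffSpec ι S} (hp : Antitone p)
    (hq : Antitone q) (hqp : ∀ i, DiffSpec.comap f hf (q i) = p i.castSucc) :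
    ∃ q' : Fin (n + 2) → DiffSpec ι S, Antitone q' ∧ (∀ i, q' i.castSucc = q i) ∧
      ∀ i, DiffSpec.comap f hf (q' i) = p i := by
  obtain ⟨r, hr, hrp⟩ := h (q (Fin.last n)) (p (Fin.last (n + 1))) (by
    rw [hqp]
    exact hp (Fin.le_last _))
  refine ⟨Fin.snoc (α := fun _ => DiffSpec ι S) q r, fun i j hij => ?_,
    fun i => Fin.snoc_castSucc (α := fun _ => DiffSpec ι S) r q i, fun i => ?_⟩
  · induction j using Fin.lastCases with
    | last =>
      induction i using Fin.lastCases with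
      | last => exact le_rfl
      | cast i =>
        rw [Fin.snoc_last, Fin.snoc_castSucc]
        exact hr.trans (hq (Fin.le_last i))
    | cast j =>
      induction i using Fin.lastCases with
      | last => exact absurd (Fin.castSucc_lt_last j) hij.not_gt
      | cast i =>
        rw [Fin.snoc_castSucc, Fin.snoc_castSucc]
        exact hq hij
  · induction i using Fin.lastCases with
    | last => rw [Fin.snoc_last]; exact hrp
    | cast i => rw [Fin.snoc_castSucc]; exact hqp i

theorem LiftsGeneralizations.hasDiffGoingDown (h : LiftsGeneralizations f hf) :
    HasDiffGoingDown f hf := by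
  intro m n hm hmn
  obtain ⟨k, rfl⟩ := Nat.exists_eq_add_of_lt hmn
  obtain ⟨m, rfl⟩ := Nat.exists_eq_add_of_le' hm
  induction k with
  | zero =>
    intro p q hp hq hqp
    exact h.exists_antitone_extension hp hq hqp
  | succ k ih =>
    intro p q hp hq hqp
    obtain ⟨q₁, hq₁, hq₁q, hq₁p⟩ := ih (by omega) (fun i => p i.castSucc) q
      (fun i j hij => hp hij) hq hqp
    obtain ⟨q₂, hq₂, hq₂q, hq₂p⟩ := h.exists_antitone_extension hp hq₁ hq₁p
    exact ⟨q₂, hq₂, fun i => (hq₂q _).trans (hq₁q i), hq₂p⟩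

/-- The prime differential ideal of the local ring at `p` given by a smaller prime differential
ideal of the base. -/
theorem DiffSpec.exists_localization_comap_eq {p p' : DiffSpec ι R} (h : p' ≤ p) :
    ∃ P : DiffSpec ι (Localization.AtPrime p.1.asIdeal),
      P.1.asIdeal.comap (algebraMap R (Localization.AtPrime p.1.asIdeal)) = p'.1.asIdeal := by
  have hd : Disjoint (p.1.asIdeal.primeCompl : Set R) p'.1.asIdeal := by
    rw [Set.disjoint_left]
    exact fun x hx hx' => hx (h hx')
  exact ⟨⟨⟨_, IsLocalization.isPrime_of_isPrime_disjoint p.1.asIdeal.primeCompl _ _ p'.1.2 hd⟩,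
    p'.2.map fun i x => (Localization.deriv_algebraMap _ i x).symm⟩,
    IsLocalization.under_map_of_isPrime_disjoint p.1.asIdeal.primeCompl _ p'.1.2 hd⟩

theorem DiffSpec.exists_le_of_localization {p : DiffSpec ι R}
    (P : DiffSpec ι (Localization.AtPrime p.1.asIdeal)) :
    ∃ p' ≤ p, P.1.asIdeal.comap (algebraMap R (Localization.AtPrime p.1.asIdeal)) =
      p'.1.asIdeal := by
  refine ⟨DiffSpec.comap (algebraMap R (Localization.AtPrime p.1.asIdeal))
    (fun i x => (Localization.deriv_algebraMap _ i x).symm) P, ?_, rfl⟩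
  intro x hx
  by_contra hcon
  exact P.1.2.ne_top (Ideal.eq_top_of_isUnit_mem _ hx
    (IsLocalization.map_units (Localization.AtPrime p.1.asIdeal)
      (⟨x, hcon⟩ : p.1.asIdeal.primeCompl)))

theorem DiffSpec.comap_localComap_asIdeal (q : DiffSpec ι S)
    (Q : DiffSpec ι (Localization.AtPrime q.1.asIdeal)) :
    (DiffSpec.localComap f hf q Q).1.asIdeal.comap (algebraMap R _) =
      (Q.1.asIdeal.comap (algebraMap S _)).comap f := by
  ext x
  change Localization.localRingHom _ q.1.asIdeal f rfl (algebraMap R _ x) ∈ Q.1.asIdeal ↔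
    algebraMap S _ (f x) ∈ Q.1.asIdeal
  rw [Localization.localRingHom_to_map]

theorem liftsGeneralizations_iff_forall_surjective_localComap :
    LiftsGeneralizations f hf ↔
      ∀ q : DiffSpec ι S, Function.Surjective (DiffSpec.localComap f hf q) := by
  refine ⟨fun h q P => ?_, fun h q p hp => ?_⟩
  · obtain ⟨p', hp', hPp'⟩ := DiffSpec.exists_le_of_localization P
    obtain ⟨q', hq', rfl⟩ := h q p' hp'
    obtain ⟨Q, hQ⟩ := DiffSpec.exists_localization_comap_eq hq'
    refine ⟨Q, ?_⟩
    apply Subtype.ext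
    apply PrimeSpectrum.localization_comap_injective
      (Localization.AtPrime (DiffSpec.comap f hf q).1.asIdeal)
      (DiffSpec.comap f hf q).1.asIdeal.primeCompl
    apply PrimeSpectrum.ext
    change (DiffSpec.localComap f hf q Q).1.asIdeal.comap (algebraMap R _) =
      P.1.asIdeal.comap (algebraMap R _)
    rw [DiffSpec.comap_localComap_asIdeal, hQ, hPp']
    rfl
  · obtain ⟨P, hP⟩ := DiffSpec.exists_localization_comap_eq hp
    obtain ⟨Q, rfl⟩ := h q P
    obtain ⟨q', hq', hQ⟩ := DiffSpec.exists_le_of_localization Q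
    refine ⟨q', hq', ?_⟩
    apply Subtype.ext
    apply PrimeSpectrum.ext
    rw [← hP, DiffSpec.comap_localComap_asIdeal, hQ]
    rfl

theorem DiffSpec.isOpen_notMem (b : R) : IsOpen {p : DiffSpec ι R | b ∉ p.1.asIdeal} :=
  (PrimeSpectrum.basicOpen b).2.preimage continuous_subtype_val

/-- A prime containing the extension of `p` and disjoint from `M` lies below `q` and contracts to
`p`; shrinking it makes it differential. Openness is what makes `M` disjoint from that extension. -/
theorem LiftsGeneralizations.of_isOpenMap [Algebra ℚ S] (h : IsOpenMap (DiffSpec.comap f hf)) :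
    LiftsGeneralizations f hf := by
  intro q p hp
  let M : Submonoid S := q.1.asIdeal.primeCompl ⊔ p.1.asIdeal.primeCompl.map f
  have hdisj : Disjoint (p.1.asIdeal.map f : Set S) M := by
    rw [Set.disjoint_left]
    intro z hz hzM
    obtain ⟨t, ht, _, ⟨s, hs, rfl⟩, rfl⟩ := Submonoid.mem_sup.1 hzM
    -- Open images are stable under generalization, so some `q'` over `p` avoids `t`; it then
    -- contains neither factor of `t * f s`, though it contains the extension of `p`.
    have hpt : p ∈ DiffSpec.comap f hf '' {q | t ∉ q.1.asIdeal} :=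
      (h _ (DiffSpec.isOpen_notMem t)).stableUnderGeneralization
        (DiffSpec.specializes_iff.2 hp) ⟨q, ht, rfl⟩
    obtain ⟨q', htq', rfl⟩ := hpt
    rcases q'.1.2.mem_or_mem ((Ideal.map_le_iff_le_comap.2 le_rfl : _ ≤ q'.1.asIdeal) hz)
      with h1 | h1
    · exact htq' h1
    · exact hs h1
  obtain ⟨Q, hQ, hle, hQM⟩ := Ideal.exists_le_prime_disjoint _ M hdisj
  have hQp : Q.comap f = p.1.asIdeal := by
    refine le_antisymm (fun x hx => ?_) (Ideal.map_le_iff_le_comap.1 hle)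
    by_contra hcon
    exact Set.disjoint_left.1 hQM hx (Submonoid.mem_sup_right ⟨x, hcon, rfl⟩)
  obtain ⟨q', hq', hq'p⟩ := DiffSpec.exists_le_comap_eq f hf p Q hQp
  refine ⟨q', fun x hx => ?_, hq'p⟩
  by_contra hcon
  exact Set.disjoint_left.1 hQM (hq' hx) (Submonoid.mem_sup_left hcon)

end

/-! ### Openness and the main equivalence. -/

theorem LiftsGeneralizations.isOpenMap {ι A B : Type*} [Finite ι] [CommRing A] [CommRing B]
    [DiffRing ι A] [DiffRing ι B] [Algebra ℚ B] [Algebra A B] [DiffAlgebra ι A B]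
    (hB : DiffFiniteType ι A B) [TopologicalSpace.NoetherianSpace (DiffSpec ι A)]
    (h : LiftsGeneralizations (algebraMap A B) (DiffAlgebra.isDiffHom_algebraMap (ι := ι))) :
    IsOpenMap (DiffSpec.comap (algebraMap A B) (DiffAlgebra.isDiffHom_algebraMap (ι := ι))) := by
  rw [((PrimeSpectrum.isTopologicalBasis_basic_opens (R := B)).induced
    (Subtype.val : DiffSpec ι B → PrimeSpectrum B)).isOpenMap_iff]
  rintro _ ⟨_, ⟨b, rfl⟩, rfl⟩
  refine TopologicalSpace.NoetherianSpace.isOpen_of_stableUnderGeneralization ?_ ?_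
  · rintro _ p hp ⟨q, hq, rfl⟩
    obtain ⟨q', hq', rfl⟩ := h q p (DiffSpec.specializes_iff.1 hp)
    exact ⟨q', fun hb => hq (hq' hb), rfl⟩
  · rintro _ ⟨q, hq, rfl⟩
    obtain ⟨a, ha, hlift⟩ :=
      hB.exists_notMem_forall_prime_exists_prime q.1.asIdeal q.2 (b := b) hq
    refine ⟨{p | a ∉ p.1.asIdeal}, DiffSpec.isOpen_notMem a, ha, ?_⟩
    -- The extension theorem gives a prime over `p` avoiding `b`; shrinking it to a differential
    -- prime still avoids `b`.
    rintro p ⟨hp, hap⟩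
    have hle := DiffSpec.specializes_iff.1 (specializes_iff_mem_closure.2 hp)
    obtain ⟨Q, hQ, hQp, hbQ⟩ := hlift p.1.asIdeal p.1.2 hle hap
    obtain ⟨q', hq', hq'p⟩ := DiffSpec.exists_le_comap_eq (algebraMap A B)
      (DiffAlgebra.isDiffHom_algebraMap (ι := ι)) p Q hQp
    exact ⟨q', fun hb => hbQ (hq' hb), hq'p⟩

theorem mainTheorem5 {ι A B : Type*} [Finite ι] [CommRing A] [CommRing B]
    [DiffRing ι A] [DiffRing ι B] [Algebra ℚ A] [Algebra A B] [DiffAlgebra ι A B]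
    (hB : DiffFiniteType ι A B) (hA : TopologicalSpace.NoetherianSpace (DiffSpec ι A)) :
    List.TFAE
      [HasDiffGoingDown (algebraMap A B) (DiffAlgebra.isDiffHom_algebraMap (ι := ι)),
       IsOpenMap
         (DiffSpec.comap (algebraMap A B) (DiffAlgebra.isDiffHom_algebraMap (ι := ι))),
       ∀ q : DiffSpec ι B, Function.Surjective
         (DiffSpec.localComap (algebraMap A B)
           (DiffAlgebra.isDiffHom_algebraMap (ι := ι)) q)] := by
  let _ : Algebra ℚ B := ((algebraMap A B).comp (algebraMap ℚ A)).toAlgebra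
  rw [← liftsGeneralizations_iff_forall_surjective_localComap]
  tfae_have 1 → 3 := HasDiffGoingDown.liftsGeneralizations
  tfae_have 3 → 1 := LiftsGeneralizations.hasDiffGoingDown
  tfae_have 2 → 3 := LiftsGeneralizations.of_isOpenMap
  tfae_have 3 → 2 := LiftsGeneralizations.isOpenMap hB
  tfae_finish
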